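/- **Definitions.** For $n\in\mathbb N_0$ and $a\in\mathbb R$ let $L_n^{a}(z)=\sum_{i=0}^n(-1)^i\binom{n+a}{n-i}\frac{z^i}{i!}$ be the Laguerre polynomial, $L_n^a=0$ for $n<0$, and let $(x)_{\overline i}=x(x+1)\cdots(x+i-1)$, $(x)_{\underline i}=x(x-1)\cdots(x-i+1)$. A Durfee symbol $[d\mid\bar d]=[d_1,\dots,d_k\mid\bar d_1,\dots,\bar d_{\bar k}]$ is a pair of weakly decreasing finite sequences of nonnegative integers ($k,\bar k\ge 0$). Its indices are $n_j=d_j+k-j\ge0$ $(1\le j\le k)$ and $\bar n_j=-(\bar d_j+\bar k-j)-1<0$ $(1\le j\le\bar k)$. Its Maya diagram is the set of filled boxes $\{n_1,\dots,n_k\}\cup\{x\in\mathbb Z: x<0,\ x\ne\bar n_1,\dots,\bar n_{\bar k}\}$. Two Durfee symbols are in the same shape class if their Maya diagrams are translates of each other in $\mathbb Z$. The canonical representative of a shape class is its member of the form $[\lambda\mid\varnothing]$ with all indices (equivalently, all parts of $\lambda$) positive. Convention: if $\bar k=0$, then $\bar d_1$ denotes $-\#\{i: d_i=0\}$. (Thus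 $-(\bar d_1+\bar k)$ is always the leftmost empty box of the Maya diagram, and the canonical $\lambda$ has length $\bar d_1+k$.) The same notations are used for a second symbol $[\delta\mid\bar\delta]=[\delta_1,\dots,\delta_\kappa\mid\bar\delta_1,\dots,\bar\delta_{\bar\kappa}]$, with indices $l_j=\delta_j+\kappa-j$ and $\bar l_j=-(\bar\delta_j+\bar\kappa-j)-1$. Put $N=k+\bar k+\kappa+\bar\kappa$. The Laguerre pseudo-Wronskian $L^{[d|\bar d]\otimes[\delta|\bar\delta]}(z;\alpha)$ is the determinant of the $N\times N$ matrix whose columns are, in this order, $\mathcal L^{(j)}$ $(1\le j\le k)$, $\overline{\mathcal L}^{(j)}$ $(1\le j\le\bar k)$, $\Lambda^{(j)}$ $(1\le j\le\kappa)$, $\overline\Lambda^{(j)}$ $(1\le j\le\bar\kappa)$, with entries for $i=1,\dots,N$ $$\mathcal L_i^{(j)}=(-1)^{i-1}L_{n_j-i+1}^{\alpha+i-1}(z),\qquad \overline{\mathcal L}_i^{(j)}=(-\bar n_j)_{\overline{i-1}}\,z^{N-i}L_{-\bar n_j+i-2}^{-\alpha-i+1}(-z),$$ $$\Lambda_i^{(j)}=(l_j-\alpha)_{\underline{i-1}}\,z^{N-i}L_{l_j}^{-\alpha-i+1}(z),\qquad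 \overline\Lambda_i^{(j)}=L_{-\bar l_j-1}^{\alpha+i-1}(-z).$$ **Statement.** Let $[d\mid\bar d]$ and $[\delta\mid\bar\delta]$ be Durfee symbols. Then their shape classes have canonical representatives $[\lambda\mid\varnothing]$ and $[\mu\mid\varnothing]$, of lengths $l(\lambda)=\bar d_1+k$ and $l(\mu)=\bar\delta_1+\kappa$, such that for every $\alpha\in\mathbb R\setminus\mathbb Z$ there is a nonzero constant $c$ (independent of $z$) with $$L^{[d|\bar d]\otimes[\delta|\bar\delta]}(z;\alpha)=c\,z^{(\bar k+\kappa)(\bar k+\kappa-1)-(\bar\delta_1+\kappa)(\bar\delta_1+\kappa-1)}\,L^{[\lambda|\varnothing]\otimes[\mu|\varnothing]}\bigl(z;\alpha-(\bar d_1+\bar k)+\bar\delta_1+\bar\kappa\bigr)$$ for all real $z\ne0$. -/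

import Mathlib

open Polynomial

noncomputable section

/-- The generalized Laguerre polynomial
`L_n^a(z) = ∑_{i ≤ n} (-1)^i * binom(n + a, n - i) * z^i / i!`, where
`binom(n + a, n - i) = (a + i + 1) (a + i + 2) ⋯ (a + n) / (n - i)!`. -/
def laguerre (n : ℕ) (a : ℝ) : ℝ[X] :=
  ∑ i ∈ Finset.range (n + 1),
    C ((-1) ^ i * ((∏ t ∈ Finset.Ioc i n, (a + t)) / (n - i).factorial) / i.factorial) * X ^ i

/-- A (generalized) Durfee symbol `[d | d̄]`: two partitions, trailing zeros allowed, whose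
lengths `k` and `k̄` are the side lengths of the Durfee rectangle. Durfee symbols are in
bijection with Maya diagrams, i.e. with punctured Young diagrams. -/
structure DurfeeSymbol where
  /-- the partition `d = (d_1 ≥ ⋯ ≥ d_k ≥ 0)` -/
  d : List ℕ
  /-- the partition `d̄ = (d̄_1 ≥ ⋯ ≥ d̄_k̄ ≥ 0)` -/
  dbar : List ℕ
  d_sorted : d.Pairwise (· ≥ ·)
  dbar_sorted : dbar.Pairwise (· ≥ ·)

namespace DurfeeSymbol

/-- The number `k` of columns above the truncated columns. -/
def k (D : DurfeeSymbol) : ℕ := D.d.length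

/-- The number `k̄` of rows left of the truncated rows. -/
def kbar (D : DurfeeSymbol) : ℕ := D.dbar.length

/-- The nonnegative Maya indices `n_1 > ⋯ > n_k ≥ 0`, with `n_j = d_j + k - j` for `1 ≤ j ≤ k`
(here `j` starts at `0`). -/
def n (D : DurfeeSymbol) (j : Fin D.k) : ℕ := D.d.get j + (D.k - 1 - j)

/-- The nonnegative numbers `-n̄_j - 1 = d̄_j + k̄ - j` for `1 ≤ j ≤ k̄`
(here `j` starts at `0`), where `n̄_1 < ⋯ < n̄_k̄ < 0` are the negative Maya indices. -/
def h (D : DurfeeSymbol) (j : Fin D.kbar) : ℕ := D.dbar.get j + (D.kbar - 1 - j)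

/-- The Maya diagram of `[d | d̄]`, as the set of its filled boxes: the boxes `n_j` are filled,
and so are all negative boxes other than the boxes `n̄_j = -h_j - 1`. -/
def maya (D : DurfeeSymbol) : Set ℤ :=
  {x | (∃ j, x = (D.n j : ℤ)) ∨ (x < 0 ∧ ∀ j, x ≠ -(D.h j : ℤ) - 1)}

/-- Two punctured Young diagrams are in the same shape class if they differ only by the position
of the origin, i.e. if their Maya diagrams are translates of each other. -/
def SameShape (D E : DurfeeSymbol) : Prop :=
  ∃ s : ℤ, ∀ x : ℤ, x ∈ D.maya ↔ x + s ∈ E.maya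

/-- `E` is the canonical representative of the shape class of `D`: it is in this shape class,
it has the form `[λ | ∅]`, and its Maya diagram is strictly positive (all its indices are
positive; equivalently all parts of `λ` are positive). -/
def IsCanonicalRep (E D : DurfeeSymbol) : Prop :=
  D.SameShape E ∧ E.dbar = [] ∧ ∀ j, 0 < E.n j

/-- The integer `d̄_1`. If `k̄ > 0` it is the first part of `d̄`. If `k̄ = 0` it is minus the number
of zero parts of `d`. In both cases `-(d̄_1 + k̄)` is the position of the leftmost empty box of
the Maya diagram. -/
def dbarOne (D : DurfeeSymbol) : ℤ :=
  match D.dbar with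
  | [] => -(D.d.count 0 : ℤ)
  | b :: _ => (b : ℤ)

end DurfeeSymbol

/-- The four types of columns of a Laguerre pseudo-Wronskian of size `N`; the row index `i` starts
at `0`, so that `N - 1 - i` stands for `N - i` and `i` for `i - 1` when rows are counted from `1`.
First type, with spectral index `n`: `(-1)^i L_{n-i}^{α+i}(z)` (zero if `i > n`). -/
def colL (α : ℝ) (n : ℕ) (i : ℕ) : ℝ[X] :=
  if i ≤ n then (-1) ^ i * laguerre (n - i) (α + i) else 0

/-- Second type, with spectral index `-(h+1)`: `(h+1)(h+2)⋯(h+i) z^{N-1-i} L_{h+i}^{-α-i}(-z)`. -/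
def colLbar (N : ℕ) (α : ℝ) (h : ℕ) (i : ℕ) : ℝ[X] :=
  C ((ascPochhammer ℝ i).eval ((h : ℝ) + 1)) * X ^ (N - 1 - i) *
    (laguerre (h + i) (-α - i)).comp (-X)

/-- Third type, with shadow index `l`:
`(l-α)(l-α-1)⋯(l-α-i+1) z^{N-1-i} L_l^{-α-i}(z)`. -/
def colLambda (N : ℕ) (α : ℝ) (l : ℕ) (i : ℕ) : ℝ[X] :=
  C ((descPochhammer ℝ i).eval ((l : ℝ) - α)) * X ^ (N - 1 - i) * laguerre l (-α - i)

/-- Fourth type, with shadow index `-(h+1)`: `L_h^{α+i}(-z)`. -/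
def colLambdaBar (α : ℝ) (h : ℕ) (i : ℕ) : ℝ[X] :=
  (laguerre h (α + i)).comp (-X)

/-- The Laguerre pseudo-Wronskian `L^{[d|d̄] ⊗ [δ|δ̄]}(z; α)`, a determinant of size
`k + k̄ + κ + κ̄` whose columns are listed in the order `n_1, …, n_k`, `n̄_1, …, n̄_k̄`,
`l_1, …, l_κ`, `l̄_1, …, l̄_κ̄`. -/
def pseudoWronskian (D Δ : DurfeeSymbol) (α : ℝ) : ℝ[X] :=
  let N := D.k + D.kbar + Δ.k + Δ.kbar
  let cols : Fin N → ℕ → ℝ[X] :=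
    Fin.append
      (Fin.append
        (Fin.append (fun j => colL α (D.n j)) (fun j => colLbar N α (D.h j)))
        (fun j => colLambda N α (Δ.n j)))
      (fun j => colLambdaBar α (Δ.h j))
  (Matrix.of fun i j : Fin N => cols j i).det

end

/-!
Translating a Maya diagram by one box changes a Laguerre pseudo-Wronskian only by a nonzero
constant, a power of `z` and a shift of `α` by one. A chain of such translations leads from any
Durfee symbol to the canonical representative of its shape class.

A translation deletes a column or, read backwards, inserts one. For each of the four column types
there is a row operator `(T f)_i = u_i f_{i-1} + v_i f_i + w f_{i+1}` that annihilates the column of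
that type with parameter `0` and sends every other column, up to a constant and possibly a factor
`z ^ 2`, to a column of the same type in a pseudo-Wronskian of size smaller by one:

* `f_{i+1}` deletes the index `0`, with `α ↦ α + 1`;
* `f_{i+1} - f_i` deletes the shadow index `-1`, with `α ↦ α + 1`;
* `z f_{i+1} + (α + i) f_i` deletes the shadow index `0`, with `α ↦ α - 1`;
* `i f_{i-1} - (α + i - z) f_i - z f_{i+1}`, which comes from the differentiated Laguerre equation,
  deletes the index `-1`, with `α ↦ α - 1`.

All of this follows from the two contiguity relations `laguerreVal_sub` and `laguerreVal_succ`. The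
row operation has determinant `w ^ n`, which the top entry of the deleted column compensates
(`det_eq_det_rowOp`). The constants are nonzero because `α` is not an integer. The last two
operators produce `z ^ 2` for each remaining column of the second and third types; these powers are
absorbed by dividing a pseudo-Wronskian with `t` such columns by `z ^ (t (t - 1))` (`Linked.delete`). If the
box `-1` is filled, the translation to the right is the first deletion read backwards, so every
symbol can be moved until its leftmost empty box is box `0`
(`DurfeeSymbol.exists_linkedTranslate_closer`).
-/

noncomputable section

/-! ### Contiguity relations of Laguerre polynomials -/

lemma laguerre_coeff_add (i j : ℕ) (a : ℝ) :
    (laguerre (i + j) a).coeff i =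
      (-1) ^ i * ((ascPochhammer ℝ j).eval (a + i + 1) / j.factorial) / i.factorial := by
  have hprod : ∏ t ∈ Finset.Ioc i (i + j), (a + (t : ℝ)) =
      (ascPochhammer ℝ j).eval (a + i + 1) := by
    induction j with
    | zero => simp
    | succ j ih =>
      rw [← add_assoc, Finset.prod_Ioc_succ_top (by omega), ih, ascPochhammer_succ_eval]
      push_cast
      ring
  simp only [laguerre, finsetSum_coeff, coeff_C_mul_X_pow]
  rw [Finset.sum_ite_eq]
  simp [hprod]

lemma laguerre_coeff_of_lt {n i : ℕ} (h : n < i) (a : ℝ) : (laguerre n a).coeff i = 0 := by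
  simp only [laguerre, finsetSum_coeff, coeff_C_mul_X_pow]
  rw [Finset.sum_ite_eq, if_neg]
  simp only [Finset.mem_range]
  omega

@[simp]
lemma laguerre_zero (a : ℝ) : laguerre 0 a = 1 := by
  simp [laguerre]

lemma eval_ascPochhammer_succ_left (j : ℕ) (b : ℝ) :
    (ascPochhammer ℝ (j + 1)).eval b = b * (ascPochhammer ℝ j).eval (b + 1) := by
  rw [ascPochhammer_succ_left]
  simp

lemma eval_descPochhammer_succ_left (j : ℕ) (b : ℝ) :
    (descPochhammer ℝ (j + 1)).eval b = b * (descPochhammer ℝ j).eval (b - 1) := by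
  rw [descPochhammer_succ_left]
  simp

lemma laguerre_sub_laguerre (n : ℕ) (a : ℝ) :
    laguerre (n + 1) (a + 1) - laguerre (n + 1) a = laguerre n (a + 1) := by
  ext i
  rw [coeff_sub]
  rcases lt_trichotomy i (n + 1) with h | rfl | h
  · obtain ⟨j, rfl⟩ := Nat.exists_eq_add_of_le (Nat.lt_succ_iff.mp h)
    rw [add_assoc, laguerre_coeff_add, laguerre_coeff_add, laguerre_coeff_add,
      eval_ascPochhammer_succ_left j (a + i + 1), ascPochhammer_succ_eval]
    rw [show a + 1 + (i : ℝ) + 1 = a + i + 1 + 1 by ring, Nat.factorial_succ]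
    have := Nat.factorial_ne_zero i
    have := Nat.factorial_ne_zero j
    push_cast
    field_simp
    ring
  · have e : ∀ b : ℝ, (laguerre (n + 1) b).coeff (n + 1) = (-1) ^ (n + 1) / (n + 1).factorial := by
      intro b
      simpa using laguerre_coeff_add (n + 1) 0 b
    rw [e, e, laguerre_coeff_of_lt (by omega), sub_self]
  · rw [laguerre_coeff_of_lt h, laguerre_coeff_of_lt h, laguerre_coeff_of_lt (by omega), sub_self]

lemma laguerre_succ_eq (n : ℕ) (a : ℝ) :
    C ((n : ℝ) + 1) * laguerre (n + 1) a =
      C ((n : ℝ) + a + 1) * laguerre n a - X * laguerre n (a + 1) := by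
  ext i
  rw [coeff_C_mul, coeff_sub, coeff_C_mul]
  rcases i with _ | i
  · have h1 := laguerre_coeff_add 0 (n + 1) a
    have h2 := laguerre_coeff_add 0 n a
    rw [zero_add] at h1 h2
    rw [h1, h2, ascPochhammer_succ_eval, Nat.factorial_succ]
    have := Nat.factorial_ne_zero n
    push_cast
    simp
    field_simp
    ring
  · rw [coeff_X_mul]
    rcases lt_trichotomy i n with h | rfl | h
    · obtain ⟨j, rfl⟩ := Nat.exists_eq_add_of_lt h
      have h1 := laguerre_coeff_add (i + 1) (j + 1) a
      have h2 := laguerre_coeff_add (i + 1) j a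
      have h3 := laguerre_coeff_add i (j + 1) (a + 1)
      rw [show i + j + 1 + 1 = i + 1 + (j + 1) by ring, h1, show i + j + 1 = i + 1 + j by ring, h2,
        show i + 1 + j = i + (j + 1) by ring, h3, ascPochhammer_succ_eval, ascPochhammer_succ_eval,
        Nat.factorial_succ, Nat.factorial_succ]
      have := Nat.factorial_ne_zero i
      have := Nat.factorial_ne_zero j
      push_cast
      rw [show a + ((i : ℝ) + 1) + 1 = a + i + 2 by ring,
        show a + 1 + (i : ℝ) + 1 = a + i + 2 by ring]
      field_simp
      ring
    · have h1 := laguerre_coeff_add (i + 1) 0 a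
      have h3 := laguerre_coeff_add i 0 (a + 1)
      simp only [add_zero] at h1 h3
      rw [h1, h3, laguerre_coeff_of_lt (by omega), Nat.factorial_succ]
      have := Nat.factorial_ne_zero i
      push_cast
      simp
      field_simp
      ring
    · rw [laguerre_coeff_of_lt (by omega), laguerre_coeff_of_lt (by omega),
        laguerre_coeff_of_lt (by omega)]
      simp

/-- The value `L_m^a(x)` of the Laguerre polynomial with integer index `m`, zero for `m < 0`. -/
def laguerreVal (m : ℤ) (a x : ℝ) : ℝ :=
  if 0 ≤ m then (laguerre m.toNat a).eval x else 0

lemma laguerreVal_natCast (n : ℕ) (a x : ℝ) : laguerreVal n a x = (laguerre n a).eval x := by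
  simp [laguerreVal]

lemma laguerreVal_of_neg {m : ℤ} (h : m < 0) (a x : ℝ) : laguerreVal m a x = 0 := by
  simp [laguerreVal, h]

@[simp]
lemma laguerreVal_zero (a x : ℝ) : laguerreVal 0 a x = 1 := by
  simp [laguerreVal]

lemma laguerreVal_sub (m : ℤ) (a x : ℝ) :
    laguerreVal m (a + 1) x - laguerreVal m a x = laguerreVal (m - 1) (a + 1) x := by
  rcases lt_trichotomy m 0 with h | rfl | h
  · rw [laguerreVal_of_neg h, laguerreVal_of_neg h, laguerreVal_of_neg (by omega), sub_self]
  · simp [laguerreVal_of_neg (m := -1)]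
  · obtain ⟨n, rfl⟩ : ∃ n : ℕ, m = (n + 1 : ℕ) := ⟨(m - 1).toNat, by omega⟩
    rw [show ((n + 1 : ℕ) : ℤ) - 1 = n by push_cast; ring]
    rw [laguerreVal_natCast, laguerreVal_natCast, laguerreVal_natCast,
      ← laguerre_sub_laguerre n, eval_sub]

lemma laguerreVal_succ (m : ℤ) (a x : ℝ) :
    ((m : ℝ) + 1) * laguerreVal (m + 1) a x =
      (m + a + 1) * laguerreVal m a x - x * laguerreVal m (a + 1) x := by
  rcases lt_trichotomy m (-1) with h | rfl | h
  · rw [laguerreVal_of_neg (by omega), laguerreVal_of_neg (by omega),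
      laguerreVal_of_neg (by omega)]
    ring
  · rw [laguerreVal_of_neg (m := -1) (by omega), laguerreVal_of_neg (m := -1) (by omega)]
    push_cast
    ring
  · obtain ⟨n, rfl⟩ : ∃ n : ℕ, m = n := ⟨m.toNat, by omega⟩
    have h1 := congrArg (eval x) (laguerre_succ_eq n a)
    simp only [eval_mul, eval_sub, eval_C, eval_X] at h1
    rw [show (n : ℤ) + 1 = (n + 1 : ℕ) by push_cast; ring]
    simp only [laguerreVal_natCast]
    push_cast
    exact h1

lemma mul_laguerreVal_sub_one (m : ℤ) (a x : ℝ) :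
    ((m : ℝ) + a) * laguerreVal m (a - 1) x =
      a * laguerreVal m a x - x * laguerreVal (m - 1) (a + 1) x := by
  have h1 := laguerreVal_sub m (a - 1) x
  have h2 := laguerreVal_succ (m - 1) a x
  rw [sub_add_cancel] at h1 h2
  push_cast at h2
  linear_combination (-(m : ℝ) - a) * h1 + h2

lemma mul_laguerreVal_succ_sub_one (m : ℤ) (a x : ℝ) :
    ((m : ℝ) + 1) * laguerreVal (m + 1) (a - 1) x =
      a * laguerreVal m a x - x * laguerreVal m (a + 1) x := by
  have h1 := laguerreVal_sub (m + 1) (a - 1) x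
  have h2 := laguerreVal_succ m a x
  rw [sub_add_cancel, add_sub_cancel_right] at h1
  linear_combination (-(m : ℝ) - 1) * h1 + h2

/-! ### Determinants and tridiagonal row operators -/

/-- The tridiagonal row operator `f ↦ (i ↦ u_i f_{i-1} + v_i f_i + w f_{i+1})`. It is used with
`u_0 = 0`, so that the truncated subtraction at `i = 0` does not matter. -/
def rowOp (u v : ℕ → ℝ) (w : ℝ) (f : ℕ → ℝ) (i : ℕ) : ℝ :=
  u i * f (i - 1) + v i * f i + w * f (i + 1)

/-- The matrix of the row operation that keeps row `0` and puts `rowOp u v w` into row `i + 1`. -/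
def rowOpMatrix (n : ℕ) (u v : ℕ → ℝ) (w : ℝ) : Matrix (Fin (n + 1)) (Fin (n + 1)) ℝ :=
  Matrix.of fun i j => Fin.cases (if j = 0 then 1 else 0)
    (fun i : Fin n => (if (j : ℕ) = i - 1 then u i else 0) + (if (j : ℕ) = i then v i else 0) +
      if (j : ℕ) = i + 1 then w else 0) i

lemma det_rowOpMatrix (n : ℕ) (u v : ℕ → ℝ) (w : ℝ) : (rowOpMatrix n u v w).det = w ^ n := by
  rw [Matrix.det_of_isLowerTriangular]
  · rw [Fin.prod_univ_succ]
    have : ∀ i : Fin n, rowOpMatrix n u v w i.succ i.succ = w := by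
      intro i
      simp only [rowOpMatrix, Matrix.of_apply, Fin.cases_succ, Fin.val_succ]
      rw [if_neg (by omega), if_neg (by omega)]
      simp
    simp only [this]
    simp [rowOpMatrix]
  · intro i j hij
    have hij : i < j := hij
    induction i using Fin.cases with
    | zero => simp [rowOpMatrix, hij.ne']
    | succ i =>
      have hij : (i : ℕ) + 1 < j := by simpa [Fin.lt_def] using hij
      simp only [rowOpMatrix, Matrix.of_apply, Fin.cases_succ]
      rw [if_neg (by omega), if_neg (by omega), if_neg (by omega)]
      simp

lemma rowOpMatrix_mul_zero (n : ℕ) (u v : ℕ → ℝ) (w : ℝ) (g : Fin (n + 1) → ℕ → ℝ)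
    (j : Fin (n + 1)) :
    (rowOpMatrix n u v w * Matrix.of fun i j : Fin (n + 1) => g j i) 0 j = g j 0 := by
  simp [Matrix.mul_apply, rowOpMatrix]

lemma rowOpMatrix_mul_succ (n : ℕ) (u v : ℕ → ℝ) (w : ℝ) (g : Fin (n + 1) → ℕ → ℝ) (i : Fin n)
    (j : Fin (n + 1)) :
    (rowOpMatrix n u v w * Matrix.of fun i j : Fin (n + 1) => g j i) i.succ j =
      rowOp u v w (g j) i := by
  have hs : ∀ (m : ℕ) (_ : m < n + 1) (c : ℝ),
      ∑ k : Fin (n + 1), (if (k : ℕ) = m then c else 0) * g j k = c * g j m := by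
    intro m hm c
    rw [Finset.sum_eq_single ⟨m, hm⟩] <;> simp +contextual [Fin.ext_iff]
  simp only [Matrix.mul_apply, rowOpMatrix, Matrix.of_apply, Fin.cases_succ, add_mul,
    Finset.sum_add_distrib]
  rw [hs _ (by omega), hs _ (by omega), hs _ (by omega), rowOp]

/-- A determinant one of whose columns is annihilated, below row `0`, by a tridiagonal row
operator is a determinant of smaller size, made of the images of the other columns. -/
lemma det_eq_det_rowOp {n : ℕ} {u v : ℕ → ℝ} {w s : ℝ} (hw : w ≠ 0)
    (g : Fin (n + 1) → ℕ → ℝ) (p : Fin (n + 1)) (h0 : g p 0 = s * w ^ n)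
    (hp : ∀ i < n, rowOp u v w (g p) i = 0) :
    (Matrix.of fun i j : Fin (n + 1) => g j i).det =
      (-1) ^ (p : ℕ) * s *
        (Matrix.of fun i j : Fin n => rowOp u v w (g (p.succAbove j)) i).det := by
  have h1 := Matrix.det_mul (rowOpMatrix n u v w) (Matrix.of fun i j : Fin (n + 1) => g j i)
  rw [det_rowOpMatrix, Matrix.det_succ_column _ p, Fin.sum_univ_succ,
    Finset.sum_eq_zero (fun i _ => by rw [rowOpMatrix_mul_succ, hp _ i.2]; simp),
    rowOpMatrix_mul_zero, h0] at h1
  have h2 : (rowOpMatrix n u v w * Matrix.of fun i j : Fin (n + 1) => g j i).submatrix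
      (Fin.succAbove 0) p.succAbove =
      Matrix.of fun i j : Fin n => rowOp u v w (g (p.succAbove j)) i := by
    ext i j
    rw [Matrix.submatrix_apply, Fin.zero_succAbove, rowOpMatrix_mul_succ, Matrix.of_apply]
  rw [h2] at h1
  apply mul_left_cancel₀ (pow_ne_zero n hw)
  rw [← h1]
  simp
  ring

/-! ### Columns of pseudo-Wronskians -/

/-- The label of a column of a Laguerre pseudo-Wronskian: one constructor for each of the four
column types. `spec n` and `shadow l` hold the index itself; `specBar h` and `shadowBar h` stand for
the negative index `-h - 1`. -/
inductive ColumnLabel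
  | spec (n : ℕ)
  | specBar (h : ℕ)
  | shadow (l : ℕ)
  | shadowBar (h : ℕ)

namespace ColumnLabel

/-- Entry `i` of the column with the given label, evaluated at `z`, in a pseudo-Wronskian of
size `N`. -/
def entry (N : ℕ) (α z : ℝ) : ColumnLabel → ℕ → ℝ
  | spec n, i => (colL α n i).eval z
  | specBar h, i => (colLbar N α h i).eval z
  | shadow l, i => (colLambda N α l i).eval z
  | shadowBar h, i => (colLambdaBar α h i).eval z

/-- The weight is `1` for the columns that carry the powers of `z`, and `0` for the others. -/
def weight : ColumnLabel → ℕ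
  | spec _ => 0
  | specBar _ => 1
  | shadow _ => 1
  | shadowBar _ => 0

lemma entry_spec (N : ℕ) (α z : ℝ) (n i : ℕ) :
    entry N α z (spec n) i = (-1) ^ i * laguerreVal ((n : ℤ) - i) (α + i) z := by
  simp only [entry, colL]
  split_ifs with h
  · rw [show (n : ℤ) - i = (n - i : ℕ) by omega, laguerreVal_natCast]
    simp
  · rw [laguerreVal_of_neg (by omega)]
    simp

lemma entry_specBar (N : ℕ) (α z : ℝ) (h i : ℕ) :
    entry N α z (specBar h) i = (ascPochhammer ℝ i).eval ((h : ℝ) + 1) * z ^ (N - 1 - i) *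
      laguerreVal (h + i) (-α - i) (-z) := by
  rw [show (h : ℤ) + i = (h + i : ℕ) by push_cast; rfl, laguerreVal_natCast]
  simp [entry, colLbar]

lemma entry_shadow (N : ℕ) (α z : ℝ) (l i : ℕ) :
    entry N α z (shadow l) i = (descPochhammer ℝ i).eval ((l : ℝ) - α) * z ^ (N - 1 - i) *
      laguerreVal l (-α - i) z := by
  simp [entry, colLambda, laguerreVal_natCast]

lemma entry_shadowBar (N : ℕ) (α z : ℝ) (h i : ℕ) :
    entry N α z (shadowBar h) i = laguerreVal h (α + i) (-z) := by
  simp [entry, colLambdaBar, laguerreVal_natCast]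

end ColumnLabel

open ColumnLabel

/-- The determinant of size `n` with the columns labelled by the list `cs`, which is meant to
have length `n`; the default value `spec 0` is then never reached. -/
def labelDet (n : ℕ) (cs : List ColumnLabel) (α z : ℝ) : ℝ :=
  (Matrix.of fun i j : Fin n => entry n α z (cs.getD j (spec 0)) i).det

section RowOperators

variable {n i : ℕ} (α z : ℝ)

/-! ### The row operator that deletes the index `0` -/

lemma rowOp_entry_spec_of_shift (m : ℕ) :
    rowOp 0 0 1 (entry (n + 1) α z (spec (m + 1))) i = -1 * entry n (α + 1) z (spec m) i := by
  simp only [rowOp, entry_spec, Pi.zero_apply]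
  push_cast
  rw [show (m : ℤ) + 1 - (i + 1) = m - i by ring, show α + (i + 1 : ℝ) = α + 1 + i by ring]
  ring

lemma rowOp_entry_specBar_of_shift (h : ℕ) :
    rowOp 0 0 1 (entry (n + 1) α z (specBar h)) i =
      (h + 1) * entry n (α + 1) z (specBar (h + 1)) i := by
  simp only [rowOp, entry_specBar, Pi.zero_apply]
  rw [eval_ascPochhammer_succ_left, show n + 1 - 1 - (i + 1) = n - 1 - i by omega]
  push_cast
  rw [show (h : ℤ) + (i + 1) = h + 1 + i by ring, show -α - (i + 1 : ℝ) = -(α + 1) - i by ring]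
  ring

lemma rowOp_entry_shadow_of_shift (l : ℕ) :
    rowOp 0 0 1 (entry (n + 1) α z (shadow l)) i =
      (l - α) * entry n (α + 1) z (shadow l) i := by
  simp only [rowOp, entry_shadow, Pi.zero_apply]
  rw [eval_descPochhammer_succ_left, show n + 1 - 1 - (i + 1) = n - 1 - i by omega]
  push_cast
  rw [show -α - (i + 1 : ℝ) = -(α + 1) - i by ring, show (l : ℝ) - (α + 1) = l - α - 1 by ring]
  ring

lemma rowOp_entry_shadowBar_of_shift (h : ℕ) :
    rowOp 0 0 1 (entry (n + 1) α z (shadowBar h)) i = 1 * entry n (α + 1) z (shadowBar h) i := by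
  simp only [rowOp, entry_shadowBar, Pi.zero_apply]
  push_cast
  rw [show α + (i + 1 : ℝ) = α + 1 + i by ring]
  ring

lemma rowOp_entry_spec_zero_of_shift :
    rowOp 0 0 1 (entry (n + 1) α z (spec 0)) i = 0 := by
  simp only [rowOp, entry_spec, Pi.zero_apply]
  rw [laguerreVal_of_neg (m := _ - ((i + 1 : ℕ) : ℤ)) (by push_cast; omega)]
  ring

/-! ### The row operator that deletes the shadow index `-1` -/

lemma rowOp_entry_spec_of_diff (m : ℕ) :
    rowOp 0 (-1) 1 (entry (n + 1) α z (spec m)) i = -1 * entry n (α + 1) z (spec m) i := by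
  simp only [rowOp, entry_spec, Pi.zero_apply, Pi.neg_apply, Pi.one_apply]
  push_cast
  rw [show α + (i + 1 : ℝ) = α + i + 1 by ring, show α + 1 + (i : ℝ) = α + i + 1 by ring,
    show (m : ℤ) - (i + 1) = m - i - 1 by ring]
  linear_combination (-1) ^ i * laguerreVal_sub (m - i) (α + i) z

lemma rowOp_entry_specBar_of_diff (h : ℕ) (hi : i < n) :
    rowOp 0 (-1) 1 (entry (n + 1) α z (specBar h)) i =
      (h - α) * entry n (α + 1) z (specBar h) i := by
  obtain ⟨r, rfl⟩ := Nat.exists_eq_add_of_lt hi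
  simp only [rowOp, entry_specBar, Pi.zero_apply, Pi.neg_apply, Pi.one_apply]
  rw [show i + r + 1 + 1 - 1 - i = r + 1 by omega, show i + r + 1 + 1 - 1 - (i + 1) = r by omega,
    show i + r + 1 - 1 - i = r by omega, ascPochhammer_succ_eval]
  have h1 := laguerreVal_succ (h + i) (-(α + 1) - i) (-z)
  push_cast at h1 ⊢
  rw [show -(α + 1) - (i : ℝ) + 1 = -α - i by ring] at h1
  rw [show -α - (i + 1 : ℝ) = -(α + 1) - i by ring, show (h : ℤ) + (i + 1) = h + i + 1 by ring]
  linear_combination (ascPochhammer ℝ i).eval ((h : ℝ) + 1) * z ^ r * h1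

lemma rowOp_entry_shadow_of_diff (l : ℕ) (hi : i < n) :
    rowOp 0 (-1) 1 (entry (n + 1) α z (shadow l)) i =
      (l + 1) * entry n (α + 1) z (shadow (l + 1)) i := by
  obtain ⟨r, rfl⟩ := Nat.exists_eq_add_of_lt hi
  simp only [rowOp, entry_shadow, Pi.zero_apply, Pi.neg_apply, Pi.one_apply]
  rw [show i + r + 1 + 1 - 1 - i = r + 1 by omega, show i + r + 1 + 1 - 1 - (i + 1) = r by omega,
    show i + r + 1 - 1 - i = r by omega, descPochhammer_succ_eval]
  have h1 := laguerreVal_succ l (-(α + 1) - i) z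
  push_cast at h1 ⊢
  rw [show -(α + 1) - (i : ℝ) + 1 = -α - i by ring] at h1
  rw [show -α - (i + 1 : ℝ) = -(α + 1) - i by ring, show (l : ℝ) + 1 - (α + 1) = l - α by ring]
  linear_combination -(descPochhammer ℝ i).eval ((l : ℝ) - α) * z ^ r * h1

lemma rowOp_entry_shadowBar_of_diff (h : ℕ) :
    rowOp 0 (-1) 1 (entry (n + 1) α z (shadowBar (h + 1))) i =
      1 * entry n (α + 1) z (shadowBar h) i := by
  simp only [rowOp, entry_shadowBar, Pi.zero_apply, Pi.neg_apply, Pi.one_apply]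
  have h1 := laguerreVal_sub (h + 1) (α + i) (-z)
  push_cast at h1 ⊢
  rw [add_sub_cancel_right] at h1
  rw [show α + (i + 1 : ℝ) = α + i + 1 by ring, show α + 1 + (i : ℝ) = α + i + 1 by ring]
  linear_combination h1

lemma rowOp_entry_shadowBar_zero_of_diff :
    rowOp 0 (-1) 1 (entry (n + 1) α z (shadowBar 0)) i = 0 := by
  simp [rowOp, entry_shadowBar]

/-! ### The row operator that deletes the shadow index `0` -/

lemma rowOp_entry_spec_of_twist (m : ℕ) :
    rowOp 0 (fun i => α + i) z (entry (n + 1) α z (spec m)) i =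
      (m + α) * entry n (α - 1) z (spec m) i := by
  simp only [rowOp, entry_spec, Pi.zero_apply]
  have h1 := mul_laguerreVal_sub_one (m - i) (α + i) z
  push_cast at h1 ⊢
  rw [show α + (i + 1 : ℝ) = α + i + 1 by ring, show α - 1 + (i : ℝ) = α + i - 1 by ring,
    show (m : ℤ) - (i + 1) = m - i - 1 by ring]
  linear_combination -(-1) ^ i * h1

lemma rowOp_entry_specBar_of_twist (h : ℕ) (hi : i < n) :
    rowOp 0 (fun i => α + i) z (entry (n + 1) α z (specBar h)) i =
      1 * z ^ 2 * entry n (α - 1) z (specBar h) i := by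
  obtain ⟨r, rfl⟩ := Nat.exists_eq_add_of_lt hi
  simp only [rowOp, entry_specBar, Pi.zero_apply]
  rw [show i + r + 1 + 1 - 1 - i = r + 1 by omega, show i + r + 1 + 1 - 1 - (i + 1) = r by omega,
    show i + r + 1 - 1 - i = r by omega, ascPochhammer_succ_eval]
  have h1 := mul_laguerreVal_succ_sub_one (h + i) (-α - i) (-z)
  push_cast at h1 ⊢
  rw [show -α - (i + 1 : ℝ) = -α - i - 1 by ring, show (h : ℤ) + (i + 1) = h + i + 1 by ring,
    show -(α - 1) - (i : ℝ) = -α - i + 1 by ring]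
  linear_combination (ascPochhammer ℝ i).eval ((h : ℝ) + 1) * z ^ (r + 1) * h1

lemma rowOp_entry_shadow_of_twist (l : ℕ) (hi : i < n) :
    rowOp 0 (fun i => α + i) z (entry (n + 1) α z (shadow (l + 1))) i =
      -1 * z ^ 2 * entry n (α - 1) z (shadow l) i := by
  obtain ⟨r, rfl⟩ := Nat.exists_eq_add_of_lt hi
  simp only [rowOp, entry_shadow, Pi.zero_apply]
  rw [show i + r + 1 + 1 - 1 - i = r + 1 by omega, show i + r + 1 + 1 - 1 - (i + 1) = r by omega,
    show i + r + 1 - 1 - i = r by omega, descPochhammer_succ_eval]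
  have h1 := mul_laguerreVal_sub_one (l + 1) (-α - i) z
  push_cast at h1 ⊢
  rw [add_sub_cancel_right] at h1
  rw [show -α - (i + 1 : ℝ) = -α - i - 1 by ring, show -(α - 1) - (i : ℝ) = -α - i + 1 by ring,
    show (l : ℝ) - (α - 1) = l + 1 - α by ring]
  linear_combination (descPochhammer ℝ i).eval ((l : ℝ) + 1 - α) * z ^ (r + 1) * h1

lemma rowOp_entry_shadowBar_of_twist (h : ℕ) :
    rowOp 0 (fun i => α + i) z (entry (n + 1) α z (shadowBar h)) i =
      (h + 1) * entry n (α - 1) z (shadowBar (h + 1)) i := by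
  simp only [rowOp, entry_shadowBar, Pi.zero_apply]
  have h1 := mul_laguerreVal_succ_sub_one h (α + i) (-z)
  push_cast at h1 ⊢
  rw [show α + (i + 1 : ℝ) = α + i + 1 by ring, show α - 1 + (i : ℝ) = α + i - 1 by ring]
  linear_combination -h1

lemma rowOp_entry_shadow_zero_of_twist (hi : i < n) :
    rowOp 0 (fun i => α + i) z (entry (n + 1) α z (shadow 0)) i = 0 := by
  obtain ⟨r, rfl⟩ := Nat.exists_eq_add_of_lt hi
  simp only [rowOp, entry_shadow, Pi.zero_apply]
  rw [show i + r + 1 + 1 - 1 - i = r + 1 by omega, show i + r + 1 + 1 - 1 - (i + 1) = r by omega,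
    descPochhammer_succ_eval]
  push_cast
  simp only [laguerreVal_zero]
  ring

/-! ### The row operator that deletes the index `-1` -/

lemma rowOp_entry_spec_of_ode (m : ℕ) :
    rowOp (fun i => i) (fun i => z - (α + i)) (-z) (entry (n + 1) α z (spec m)) i =
      -(m + 1) * entry n (α - 1) z (spec (m + 1)) i := by
  have h0 : (i : ℝ) * entry (n + 1) α z (spec m) (i - 1) =
      -(i * (-1) ^ i * laguerreVal (m - i + 1) (α + i - 1) z) := by
    rcases i with _ | i
    · simp
    · rw [entry_spec]
      push_cast
      rw [show (m : ℤ) - (i + 1) + 1 = m - i by ring, show α + (i + 1 : ℝ) - 1 = α + i by ring]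
      ring
  rw [rowOp, h0]
  simp only [entry_spec]
  have h1 := mul_laguerreVal_succ_sub_one (m - i) (α + i) z
  have h2 := laguerreVal_sub (m - i) (α + i) z
  push_cast at h1 ⊢
  rw [show α + (i + 1 : ℝ) = α + i + 1 by ring, show α - 1 + (i : ℝ) = α + i - 1 by ring,
    show (m : ℤ) - (i + 1) = m - i - 1 by ring, show (m : ℤ) + 1 - i = m - i + 1 by ring]
  linear_combination (-1) ^ i * (h1 - z * h2)

lemma rowOp_entry_specBar_of_ode (h : ℕ) (hi : i < n) :
    rowOp (fun i => i) (fun i => z - (α + i)) (-z) (entry (n + 1) α z (specBar (h + 1))) i =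
      -1 * z ^ 2 * entry n (α - 1) z (specBar h) i := by
  obtain ⟨r, rfl⟩ := Nat.exists_eq_add_of_lt hi
  -- `q` stands for `(h + 2) ⋯ (h + i)`, read as `1 / (h + 1)` when `i = 0`.
  obtain ⟨q, hq, hq1, h0⟩ : ∃ q : ℝ,
      (ascPochhammer ℝ i).eval ((h : ℝ) + 1) = (h + 1) * q ∧
      (ascPochhammer ℝ i).eval ((h : ℝ) + 1 + 1) = q * (h + 1 + i) ∧
      (i : ℝ) * entry (i + r + 1 + 1) α z (specBar (h + 1)) (i - 1) =
        i * q * z ^ (r + 2) * laguerreVal (h + i) (-α - i + 1) (-z) := by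
    rcases i with _ | i
    · have : (h : ℝ) + 1 ≠ 0 := by positivity
      exact ⟨1 / (h + 1), by simp; field_simp, by simp; field_simp, by simp⟩
    · refine ⟨(ascPochhammer ℝ i).eval ((h : ℝ) + 1 + 1), ?_, ?_, ?_⟩
      · rw [eval_ascPochhammer_succ_left]
      · rw [ascPochhammer_succ_eval]
        push_cast
        ring
      · rw [entry_specBar, Nat.add_sub_cancel,
          show i + 1 + r + 1 + 1 - 1 - i = r + 2 by omega]
        push_cast
        rw [show (h : ℤ) + 1 + i = h + (i + 1) by ring,
          show -α - (i + 1 : ℝ) + 1 = -α - i by ring]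
        ring
  rw [rowOp, h0]
  simp only [entry_specBar]
  rw [show i + r + 1 + 1 - 1 - i = r + 1 by omega, show i + r + 1 + 1 - 1 - (i + 1) = r by omega,
    show i + r + 1 - 1 - i = r by omega, ascPochhammer_succ_eval]
  push_cast
  rw [hq, hq1]
  have h1 := mul_laguerreVal_succ_sub_one (h + 1 + i) (-α - i) (-z)
  have h2 := laguerreVal_sub (h + 1 + i) (-α - i) (-z)
  push_cast at h1 h2
  rw [show (h : ℤ) + 1 + i - 1 = h + i by ring] at h2
  rw [show -α - (i + 1 : ℝ) = -α - i - 1 by ring, show -(α - 1) - (i : ℝ) = -α - i + 1 by ring,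
    show (h : ℤ) + 1 + (i + 1) = h + 1 + i + 1 by ring]
  linear_combination q * (h + 1 + i) * z ^ (r + 1) * (-h1 - z * h2)

lemma rowOp_entry_shadow_of_ode (l : ℕ) (hα : (l : ℝ) + 1 - α ≠ 0) (hi : i < n) :
    rowOp (fun i => i) (fun i => z - (α + i)) (-z) (entry (n + 1) α z (shadow l)) i =
      1 * z ^ 2 * entry n (α - 1) z (shadow l) i := by
  obtain ⟨r, rfl⟩ := Nat.exists_eq_add_of_lt hi
  -- `q` stands for `(l - α) ⋯ (l - α - i + 2)`, read as `1 / (l + 1 - α)` when `i = 0`.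
  obtain ⟨q, hq, hq1, h0⟩ : ∃ q : ℝ,
      (descPochhammer ℝ i).eval ((l : ℝ) - (α - 1)) = (l + 1 - α) * q ∧
      (descPochhammer ℝ i).eval ((l : ℝ) - α) = q * (l + 1 - α - i) ∧
      (i : ℝ) * entry (i + r + 1 + 1) α z (shadow l) (i - 1) =
        i * q * z ^ (r + 2) * laguerreVal l (-α - i + 1) z := by
    rcases i with _ | i
    · exact ⟨1 / (l + 1 - α), by simp; field_simp, by simp; field_simp, by simp⟩
    · refine ⟨(descPochhammer ℝ i).eval ((l : ℝ) - α), ?_, ?_, ?_⟩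
      · rw [eval_descPochhammer_succ_left, show (l : ℝ) - (α - 1) - 1 = l - α by ring]
        ring
      · rw [descPochhammer_succ_eval]
        push_cast
        ring
      · rw [entry_shadow, Nat.add_sub_cancel,
          show i + 1 + r + 1 + 1 - 1 - i = r + 2 by omega]
        push_cast
        rw [show -α - (i + 1 : ℝ) + 1 = -α - i by ring]
        ring
  rw [rowOp, h0]
  simp only [entry_shadow]
  rw [show i + r + 1 + 1 - 1 - i = r + 1 by omega, show i + r + 1 + 1 - 1 - (i + 1) = r by omega,
    show i + r + 1 - 1 - i = r by omega, descPochhammer_succ_eval, hq, hq1]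
  have h1 := mul_laguerreVal_sub_one l (-α - i) z
  have h2 := laguerreVal_sub l (-α - i) z
  push_cast at h1 ⊢
  rw [show -α - (i + 1 : ℝ) = -α - i - 1 by ring, show -(α - 1) - (i : ℝ) = -α - i + 1 by ring]
  linear_combination q * (l + 1 - α - i) * z ^ (r + 1) * (-h1 - z * h2)

lemma rowOp_entry_shadowBar_of_ode (h : ℕ) :
    rowOp (fun i => i) (fun i => z - (α + i)) (-z) (entry (n + 1) α z (shadowBar h)) i =
      -(h + α) * entry n (α - 1) z (shadowBar h) i := by
  have h0 : (i : ℝ) * entry (n + 1) α z (shadowBar h) (i - 1) =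
      i * laguerreVal h (α + i - 1) (-z) := by
    rcases i with _ | i
    · simp
    · rw [entry_shadowBar, Nat.add_sub_cancel]
      push_cast
      rw [show α + (i + 1 : ℝ) - 1 = α + i by ring]
  rw [rowOp, h0]
  simp only [entry_shadowBar]
  have h1 := mul_laguerreVal_sub_one h (α + i) (-z)
  have h2 := laguerreVal_sub h (α + i) (-z)
  push_cast at h1 ⊢
  rw [show α + (i + 1 : ℝ) = α + i + 1 by ring, show α - 1 + (i : ℝ) = α + i - 1 by ring]
  linear_combination h1 - z * h2

lemma rowOp_entry_specBar_zero_of_ode (hi : i < n) :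
    rowOp (fun i => i) (fun i => z - (α + i)) (-z) (entry (n + 1) α z (specBar 0)) i = 0 := by
  obtain ⟨r, rfl⟩ := Nat.exists_eq_add_of_lt hi
  have h0 : (i : ℝ) * entry (i + r + 1 + 1) α z (specBar 0) (i - 1) =
      (ascPochhammer ℝ i).eval 1 * z ^ (r + 2) * laguerreVal (i - 1) (-α - i + 1) (-z) := by
    rcases i with _ | i
    · simp [laguerreVal_of_neg (m := -1)]
    · rw [entry_specBar, Nat.add_sub_cancel, show i + 1 + r + 1 + 1 - 1 - i = r + 2 by omega,
        ascPochhammer_succ_eval]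
      push_cast
      rw [show (0 : ℤ) + i = i + 1 - 1 by ring, show -α - (i + 1 : ℝ) + 1 = -α - i by ring]
      simp only [zero_add]
      ring
  rw [rowOp, h0]
  simp only [entry_specBar]
  rw [show i + r + 1 + 1 - 1 - i = r + 1 by omega, show i + r + 1 + 1 - 1 - (i + 1) = r by omega,
    ascPochhammer_succ_eval]
  have h1 := mul_laguerreVal_succ_sub_one i (-α - i) (-z)
  have h2 := laguerreVal_sub i (-α - i) (-z)
  push_cast at h1 ⊢
  simp only [zero_add]
  rw [show -α - (i + 1 : ℝ) = -α - i - 1 by ring]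
  linear_combination (ascPochhammer ℝ i).eval 1 * z ^ (r + 1) * (-h1 - z * h2)

end RowOperators

/-! ### Deleting a column -/

/-- The total weight of a list of columns; it is `k̄ + κ` for a pair of Durfee symbols. -/
def totalWeight (cs : List ColumnLabel) : ℕ := (cs.map weight).sum

/-- The determinant with the columns `cs`, divided by the power `z ^ (t (t - 1))` of `z`, where `t`
is the total weight of the columns. -/
def normDet (cs : List ColumnLabel) (α z : ℝ) : ℝ :=
  z ^ (-((totalWeight cs : ℤ) * (totalWeight cs - 1))) * labelDet cs.length cs α z

/-- The normalized determinants of `cs` at `α` and of `cs'` at `α'` agree, as functions of `z ≠ 0`,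
up to a nonzero constant. -/
def Linked (cs : List ColumnLabel) (α : ℝ) (cs' : List ColumnLabel) (α' : ℝ) : Prop :=
  ∃ c : ℝ, c ≠ 0 ∧ ∀ z : ℝ, z ≠ 0 → normDet cs α z = c * normDet cs' α' z

lemma Linked.refl (cs : List ColumnLabel) (α : ℝ) : Linked cs α cs α :=
  ⟨1, one_ne_zero, fun _ _ => (one_mul _).symm⟩

lemma Linked.symm {cs cs' : List ColumnLabel} {α α' : ℝ} (h : Linked cs α cs' α') :
    Linked cs' α' cs α := by
  obtain ⟨c, hc, h⟩ := h
  refine ⟨c⁻¹, inv_ne_zero hc, fun z hz => ?_⟩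
  rw [h z hz, inv_mul_cancel_left₀ hc]

lemma Linked.trans {cs cs' cs'' : List ColumnLabel} {α α' α'' : ℝ} (h : Linked cs α cs' α')
    (h' : Linked cs' α' cs'' α'') : Linked cs α cs'' α'' := by
  obtain ⟨c, hc, h⟩ := h
  obtain ⟨c', hc', h'⟩ := h'
  exact ⟨c * c', mul_ne_zero hc hc', fun z hz => by rw [h z hz, h' z hz, mul_assoc]⟩

lemma getD_append_cons_succAbove {β : Type*} (l₁ l₂ : List β) (c d : β) {n : ℕ}
    (p : Fin (n + 1)) (hp : (p : ℕ) = l₁.length) (j : Fin n) :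
    (l₁ ++ c :: l₂).getD (p.succAbove j) d = (l₁ ++ l₂).getD j d := by
  by_cases h : (j : ℕ) < l₁.length
  · rw [Fin.succAbove_of_castSucc_lt _ _ (by simp [Fin.lt_def, hp, h])]
    rw [Fin.val_castSucc, List.getD_append _ _ _ _ h, List.getD_append _ _ _ _ h]
  · rw [Fin.succAbove_of_le_castSucc _ _ (by simp [Fin.le_def, hp]; omega), Fin.val_succ]
    rw [List.getD_append_right _ _ _ _ (by omega), List.getD_append_right _ _ _ _ (by omega),
      show (j : ℕ) + 1 - l₁.length = j - l₁.length + 1 by omega, List.getD_cons_succ]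

lemma det_getD_of_smul {β : Type*} (n : ℕ) (l : List β) (d : β) (hl : l.length = n)
    (F G : β → ℕ → ℝ) (c : β → ℝ) (h : ∀ x ∈ l, ∀ i < n, F x i = c x * G x i) :
    (Matrix.of fun i j : Fin n => F (l.getD j d) i).det =
      (l.map c).prod * (Matrix.of fun i j : Fin n => G (l.getD j d) i).det := by
  subst hl
  have h1 := Matrix.det_mul_row (fun j : Fin l.length => c (l.getD j d))
    (Matrix.of fun i j : Fin l.length => G (l.getD j d) i)
  have h2 : (l.map c).prod = ∏ j : Fin l.length, c (l.getD j d) := by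
    rw [← Fin.prod_univ_fun_getElem]
    exact Finset.prod_congr rfl fun j _ => by rw [List.getD_eq_getElem _ _ j.2]
  rw [h2, ← h1]
  congr 1
  ext i j
  simp only [Matrix.of_apply]
  rw [h _ _ i i.2]
  rw [List.getD_eq_getElem _ _ j.2]
  exact List.getElem_mem _

lemma prod_map_mul_pow (l : List ColumnLabel) (c : ColumnLabel → ℝ) (z : ℝ) (e : ℕ) :
    (l.map fun x => c x * z ^ (e * weight x)).prod =
      (l.map c).prod * z ^ (e * totalWeight l) := by
  induction l with
  | nil => simp [totalWeight]
  | cons x l ih =>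
    simp only [totalWeight, List.map_cons, List.prod_cons, List.sum_cons] at ih ⊢
    rw [ih, mul_add, pow_add]
    ring

/-- If a row operator annihilates the column `c₀` and maps each of the other columns to a multiple
of the column with the label given by `σ`, then `c₀` can be deleted. -/
lemma Linked.delete {l₁ l₂ : List ColumnLabel} {c₀ : ColumnLabel} {α α' s : ℝ}
    (u v : ℝ → ℕ → ℝ) (w : ℝ → ℝ) (σ : ColumnLabel → ColumnLabel) (c : ColumnLabel → ℝ)
    (hs : s ≠ 0) (hw : ∀ z ≠ 0, w z ≠ 0)
    (h0 : ∀ z, entry ((l₁ ++ l₂).length + 1) α z c₀ 0 = s * w z ^ (l₁ ++ l₂).length)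
    (hc₀ : ∀ z, ∀ i < (l₁ ++ l₂).length,
      rowOp (u z) (v z) (w z) (entry ((l₁ ++ l₂).length + 1) α z c₀) i = 0)
    (hσ : ∀ x, weight (σ x) = weight x) (hc : ∀ x ∈ l₁ ++ l₂, c x ≠ 0)
    (h : ∀ x ∈ l₁ ++ l₂, ∀ z, ∀ i < (l₁ ++ l₂).length,
      rowOp (u z) (v z) (w z) (entry ((l₁ ++ l₂).length + 1) α z x) i =
        c x * z ^ (2 * weight c₀ * weight x) * entry (l₁ ++ l₂).length α' z (σ x) i) :
    Linked (l₁ ++ c₀ :: l₂) α ((l₁ ++ l₂).map σ) α' := by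
  have ht : totalWeight (l₁ ++ c₀ :: l₂) = weight c₀ + totalWeight (l₁ ++ l₂) := by
    simp only [totalWeight, List.map_append, List.map_cons, List.sum_append, List.sum_cons]
    ring
  have ht' : totalWeight ((l₁ ++ l₂).map σ) = totalWeight (l₁ ++ l₂) := by
    simp only [totalWeight, List.map_map]
    congr 2
    ext x
    exact hσ x
  have hlen : (l₁ ++ c₀ :: l₂).length = (l₁ ++ l₂).length + 1 := by
    simp only [List.length_append, List.length_cons]
    omega
  have hlen' : l₁.length < (l₁ ++ l₂).length + 1 := by
    simp only [List.length_append]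
    omega
  refine ⟨(-1) ^ l₁.length * s * ((l₁ ++ l₂).map c).prod,
    mul_ne_zero (mul_ne_zero (pow_ne_zero _ (by norm_num)) hs) ?_, fun z hz => ?_⟩
  · exact List.prod_ne_zero (by simpa [or_imp, forall_and] using hc)
  · have h1 := det_eq_det_rowOp (u := u z) (v := v z) (hw z hz)
      (fun j => entry ((l₁ ++ l₂).length + 1) α z ((l₁ ++ c₀ :: l₂).getD j (spec 0)))
      ⟨l₁.length, hlen'⟩ (s := s) (by simpa using h0 z)
      (by simpa [List.getD_append_right] using hc₀ z)
    simp only [getD_append_cons_succAbove l₁ l₂ c₀ (spec 0) ⟨l₁.length, hlen'⟩ rfl] at h1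
    rw [det_getD_of_smul _ (l₁ ++ l₂) (spec 0) rfl
      (fun x => rowOp (u z) (v z) (w z) (entry ((l₁ ++ l₂).length + 1) α z x))
      (fun x => entry (l₁ ++ l₂).length α' z (σ x))
      (fun x => c x * z ^ (2 * weight c₀ * weight x)) (fun x hx i hi => h x hx z i hi),
      prod_map_mul_pow] at h1
    have h2 : labelDet ((l₁ ++ l₂).map σ).length ((l₁ ++ l₂).map σ) α' z =
        (Matrix.of fun i j : Fin (l₁ ++ l₂).length =>
          entry (l₁ ++ l₂).length α' z (σ ((l₁ ++ l₂).getD j (spec 0))) i).det := by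
      rw [List.length_map, labelDet]
      congr 1
      ext i j
      simp only [Matrix.of_apply]
      rw [List.getD_eq_getElem _ _ (by simpa using j.2), List.getD_eq_getElem _ _ j.2,
        List.getElem_map]
    rw [normDet, normDet, h2, hlen, labelDet, h1, ht, ht']
    have h3 : ∀ t : ℕ, z ^ (-(((weight c₀ + t : ℕ) : ℤ) * ((weight c₀ + t : ℕ) - 1))) *
        z ^ (2 * weight c₀ * t) = z ^ (-((t : ℤ) * (t - 1))) := by
      intro t
      rw [← zpow_natCast, ← zpow_add₀ hz]
      congr 1
      have : weight c₀ = 0 ∨ weight c₀ = 1 := by cases c₀ <;> simp [weight]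
      rcases this with e | e <;> rw [e] <;> push_cast <;> ring
    rw [← h3 (totalWeight (l₁ ++ l₂))]
    ring

/-- The columns attached to the pair of lists of indices `A | B` and shadow indices `C | E`. -/
def columns (A B C E : List ℕ) : List ColumnLabel :=
  A.map spec ++ B.map specBar ++ C.map shadow ++ E.map shadowBar

lemma totalWeight_columns (A B C E : List ℕ) :
    totalWeight (columns A B C E) = B.length + C.length := by
  simp [totalWeight, columns, Function.comp_def, weight]

/-- Deleting the index `0` translates the remaining indices to the left. -/
lemma Linked.columns_spec_zero (A B C E : List ℕ) {α : ℝ} (hα : ∀ a : ℤ, α ≠ a) :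
    Linked (columns (A.map (· + 1) ++ [0]) B C E) α (columns A (B.map (· + 1)) C E) (α + 1) := by
  have := Linked.delete (l₁ := (A.map (· + 1)).map spec)
    (l₂ := B.map specBar ++ C.map shadow ++ E.map shadowBar) (c₀ := spec 0) (α := α)
    (α' := α + 1) (s := 1) (fun _ => 0) (fun _ => 0) (fun _ => 1)
    (fun | spec n => spec (n - 1) | specBar h => specBar (h + 1) | x => x)
    (fun | spec _ => -1 | specBar h => h + 1 | shadow l => l - α | shadowBar _ => 1)
    one_ne_zero (fun _ _ => one_ne_zero) (fun z => by simp [entry_spec])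
    (fun z i _ => rowOp_entry_spec_zero_of_shift α z) (by rintro (_ | _ | _ | _) <;> rfl)
    (by
      rintro (n | h | l | h) - <;> simp only
      · norm_num
      · positivity
      · exact fun e => hα l (by push_cast; linarith)
      · norm_num)
    (by
      rintro (n | h | l | h) hx z i - <;> simp only [weight, mul_zero, pow_zero, mul_one]
      · obtain ⟨m, rfl⟩ : ∃ m, n = m + 1 := by
          simp at hx
          obtain ⟨m, -, rfl⟩ := hx
          exact ⟨m, rfl⟩
        exact rowOp_entry_spec_of_shift α z m
      · exact rowOp_entry_specBar_of_shift α z h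
      · exact rowOp_entry_shadow_of_shift α z l
      · exact rowOp_entry_shadowBar_of_shift α z h)
  simpa [columns, Function.comp_def] using this

/-- Deleting the shadow index `-1` translates the remaining shadow indices to the right. -/
lemma Linked.columns_shadowBar_zero (A B C E : List ℕ) {α : ℝ} (hα : ∀ a : ℤ, α ≠ a) :
    Linked (columns A B C (E.map (· + 1) ++ [0])) α (columns A B (C.map (· + 1)) E) (α + 1) := by
  have := Linked.delete
    (l₁ := A.map spec ++ B.map specBar ++ C.map shadow ++ (E.map (· + 1)).map shadowBar)
    (l₂ := []) (c₀ := shadowBar 0) (α := α)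
    (α' := α + 1) (s := 1) (fun _ => 0) (fun _ => -1) (fun _ => 1)
    (fun | shadowBar h => shadowBar (h - 1) | shadow l => shadow (l + 1) | x => x)
    (fun | spec _ => -1 | specBar h => h - α | shadow l => l + 1 | shadowBar _ => 1)
    one_ne_zero (fun _ _ => one_ne_zero) (fun z => by simp [entry_shadowBar])
    (fun z i _ => rowOp_entry_shadowBar_zero_of_diff α z) (by rintro (_ | _ | _ | _) <;> rfl)
    (by
      rintro (n | h | l | h) - <;> simp only
      · norm_num
      · exact fun e => hα h (by push_cast; linarith)
      · positivity
      · norm_num)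
    (by
      rintro (n | h | l | h) hx z i hi <;>
        simp only [weight, mul_zero, pow_zero, mul_one]
      · exact rowOp_entry_spec_of_diff α z n
      · exact rowOp_entry_specBar_of_diff α z h hi
      · exact rowOp_entry_shadow_of_diff α z l hi
      · obtain ⟨m, rfl⟩ : ∃ m, h = m + 1 := by
          simp at hx
          obtain ⟨m, -, rfl⟩ := hx
          exact ⟨m, rfl⟩
        exact rowOp_entry_shadowBar_of_diff α z m)
  simpa [columns, Function.comp_def] using this

/-- Deleting the shadow index `0` translates the remaining shadow indices to the left. -/
lemma Linked.columns_shadow_zero (A B C E : List ℕ) {α : ℝ} (hα : ∀ a : ℤ, α ≠ a) :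
    Linked (columns A B (C.map (· + 1) ++ [0]) E) α (columns A B C (E.map (· + 1))) (α - 1) := by
  have := Linked.delete
    (l₁ := A.map spec ++ B.map specBar ++ (C.map (· + 1)).map shadow)
    (l₂ := E.map shadowBar) (c₀ := shadow 0) (α := α)
    (α' := α - 1) (s := 1) (fun _ => 0) (fun _ i => α + i) (fun z => z)
    (fun | shadow l => shadow (l - 1) | shadowBar h => shadowBar (h + 1) | x => x)
    (fun | spec n => n + α | specBar _ => 1 | shadow _ => -1 | shadowBar h => h + 1)
    one_ne_zero (fun _ hz => hz) (fun z => by simp [entry_shadow])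
    (fun z i hi => rowOp_entry_shadow_zero_of_twist α z hi) (by rintro (_ | _ | _ | _) <;> rfl)
    (by
      rintro (n | h | l | h) - <;> simp only
      · exact fun e => hα (-n) (by push_cast; linarith)
      · norm_num
      · norm_num
      · positivity)
    (by
      rintro (n | h | l | h) hx z i hi <;> simp only [weight, mul_zero, pow_zero, mul_one]
      · exact rowOp_entry_spec_of_twist α z n
      · exact rowOp_entry_specBar_of_twist α z h hi
      · obtain ⟨m, rfl⟩ : ∃ m, l = m + 1 := by
          simp at hx
          obtain ⟨m, -, rfl⟩ := hx
          exact ⟨m, rfl⟩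
        exact rowOp_entry_shadow_of_twist α z m hi
      · exact rowOp_entry_shadowBar_of_twist α z h)
  simpa [columns, Function.comp_def] using this

/-- Deleting the index `-1` translates the remaining indices to the right. -/
lemma Linked.columns_specBar_zero (A B C E : List ℕ) {α : ℝ} (hα : ∀ a : ℤ, α ≠ a) :
    Linked (columns A (B.map (· + 1) ++ [0]) C E) α (columns (A.map (· + 1)) B C E) (α - 1) := by
  have := Linked.delete
    (l₁ := A.map spec ++ (B.map (· + 1)).map specBar)
    (l₂ := C.map shadow ++ E.map shadowBar) (c₀ := specBar 0) (α := α) (α' := α - 1)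
    (s := (-1) ^ (A.map spec ++ (B.map (· + 1)).map specBar ++
      (C.map shadow ++ E.map shadowBar)).length)
    (fun _ i => i) (fun z i => z - (α + i)) (fun z => -z)
    (fun | spec n => spec (n + 1) | specBar h => specBar (h - 1) | x => x)
    (fun | spec n => -(n + 1) | specBar _ => -1 | shadow _ => 1 | shadowBar h => -(h + α))
    (by simp) (fun _ hz => neg_ne_zero.mpr hz)
    (fun z => by rw [← mul_pow]; simp [entry_specBar])
    (fun z i hi => rowOp_entry_specBar_zero_of_ode α z hi) (by rintro (_ | _ | _ | _) <;> rfl)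
    (by
      rintro (n | h | l | h) - <;> simp only
      · rw [neg_ne_zero]
        positivity
      · norm_num
      · norm_num
      · exact fun e => hα (-h) (by push_cast; linarith))
    (by
      rintro (n | h | l | h) hx z i hi <;> simp only [weight, mul_zero, pow_zero, mul_one]
      · exact rowOp_entry_spec_of_ode α z n
      · obtain ⟨m, rfl⟩ : ∃ m, h = m + 1 := by
          simp at hx
          obtain ⟨m, -, rfl⟩ := hx
          exact ⟨m, rfl⟩
        exact rowOp_entry_specBar_of_ode α z m hi
      · exact rowOp_entry_shadow_of_ode α z l
          (fun e => hα (l + 1) (by push_cast; linarith)) hi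
      · exact rowOp_entry_shadowBar_of_ode α z h)
  simpa [columns, Function.comp_def] using this

/-! ### Durfee symbols and their translates -/

namespace DurfeeSymbol

/-- The strictly decreasing list of the numbers `d_j + k - j` of a partition `d` of length `k`. -/
def indices : List ℕ → List ℕ
  | [] => []
  | a :: l => (a + l.length) :: indices l

@[simp]
lemma length_indices (l : List ℕ) : (indices l).length = l.length := by
  induction l with
  | nil => rfl
  | cons a l ih => simp [indices, ih]

lemma getElem_indices (l : List ℕ) (j : ℕ) (hj : j < l.length) :
    (indices l)[j]'(by simpa using hj) = l[j] + (l.length - 1 - j) := by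
  induction l generalizing j with
  | nil => simp at hj
  | cons a l ih =>
    rcases j with _ | j
    · simp [indices]
    · have hj : j < l.length := by simpa using hj
      simp only [indices, List.getElem_cons_succ, ih j hj, List.length_cons]
      omega

lemma indices_concat (l : List ℕ) (a : ℕ) :
    indices (l ++ [a]) = (indices l).map (· + 1) ++ [a] := by
  induction l with
  | nil => simp [indices]
  | cons b l ih =>
    simp [indices, ih]
    ring

lemma indices_map_succ (l : List ℕ) :
    indices (l.map (· + 1)) = (indices l).map (· + 1) := by
  induction l with
  | nil => simp [indices]
  | cons b l ih =>
    simp [indices, ih]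
    ring

lemma ofFn_n (D : DurfeeSymbol) : List.ofFn D.n = indices D.d := by
  change List.ofFn (fun j : Fin D.d.length => D.d.get j + (D.d.length - 1 - j)) = _
  apply List.ext_getElem
  · simp
  · intro j h1 h2
    rw [getElem_indices _ _ (by simpa using h2)]
    simp

lemma ofFn_h (D : DurfeeSymbol) : List.ofFn D.h = indices D.dbar := by
  change List.ofFn (fun j : Fin D.dbar.length => D.dbar.get j + (D.dbar.length - 1 - j)) = _
  apply List.ext_getElem
  · simp
  · intro j h1 h2
    rw [getElem_indices _ _ (by simpa using h2)]
    simp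

lemma mem_maya_iff (D : DurfeeSymbol) (x : ℤ) :
    x ∈ D.maya ↔ (∃ n ∈ indices D.d, x = n) ∨ (x < 0 ∧ ∀ h ∈ indices D.dbar, x ≠ -(h : ℤ) - 1) := by
  simp [maya, ← ofFn_n, ← ofFn_h, List.mem_ofFn]

/-- The labels of the columns of the pseudo-Wronskian of `D ⊗ Δ`. -/
def labels (D Δ : DurfeeSymbol) : List ColumnLabel :=
  columns (indices D.d) (indices D.dbar) (indices Δ.d) (indices Δ.dbar)

lemma length_labels (D Δ : DurfeeSymbol) :
    (labels D Δ).length = D.k + D.kbar + Δ.k + Δ.kbar := by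
  simp [labels, columns, k, kbar, add_assoc]

lemma totalWeight_labels (D Δ : DurfeeSymbol) : totalWeight (labels D Δ) = D.kbar + Δ.k := by
  simp [labels, totalWeight_columns, k, kbar]

lemma labels_eq_ofFn (D Δ : DurfeeSymbol) :
    labels D Δ = List.ofFn (Fin.append
      (Fin.append
        (Fin.append (fun j => spec (D.n j)) (fun j => specBar (D.h j)))
        (fun j => shadow (Δ.n j)))
      (fun j => shadowBar (Δ.h j))) := by
  simp only [List.ofFn_fin_append, labels, columns, ← ofFn_n, ← ofFn_h, List.map_ofFn]
  rfl

lemma getD_ofFn {β : Type*} {n : ℕ} (f : Fin n → β) (j : Fin n) (d : β) :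
    (List.ofFn f).getD j d = f j := by
  rw [List.getD_eq_getElem _ _ (by simp)]
  simp

lemma eval_pseudoWronskian (D Δ : DurfeeSymbol) (α z : ℝ) :
    (pseudoWronskian D Δ α).eval z = labelDet (labels D Δ).length (labels D Δ) α z := by
  rw [length_labels, labels_eq_ofFn, pseudoWronskian, labelDet, ← coe_evalRingHom,
    RingHom.map_det, RingHom.mapMatrix_apply]
  congr 1
  ext i j
  rw [Matrix.map_apply, Matrix.of_apply, Matrix.of_apply, getD_ofFn, coe_evalRingHom]
  refine Fin.addCases (fun j => ?_) (fun j => ?_) j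
  · refine Fin.addCases (fun j => ?_) (fun j => ?_) j
    · refine Fin.addCases (fun j => ?_) (fun j => ?_) j <;> simp [entry]
    · simp [entry]
  · simp [entry]

/-- `D'` is `D` with its Maya diagram translated by `e`, and the pseudo-Wronskians of `D` and `D'`,
completed on either side by an arbitrary third symbol, are linked. -/
structure LinkedTranslate (D D' : DurfeeSymbol) (e : ℤ) : Prop where
  mem_maya : ∀ x, x ∈ D.maya ↔ x + e ∈ D'.maya
  dbarOne_add_k : D'.dbarOne + D'.k = D.dbarOne + D.k
  dbarOne_add_kbar : D'.dbarOne + D'.kbar = D.dbarOne + D.kbar - e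
  linked_left : ∀ (Δ : DurfeeSymbol) (α : ℝ), (∀ a : ℤ, α ≠ a) →
    Linked (labels D Δ) α (labels D' Δ) (α - e)
  linked_right : ∀ (Δ : DurfeeSymbol) (α : ℝ), (∀ a : ℤ, α ≠ a) →
    Linked (labels Δ D) α (labels Δ D') (α + e)

lemma forall_add_intCast_ne {α : ℝ} (hα : ∀ a : ℤ, α ≠ a) (e : ℤ) (a : ℤ) : α + e ≠ a :=
  fun h => hα (a - e) (by push_cast; linarith)

lemma forall_sub_intCast_ne {α : ℝ} (hα : ∀ a : ℤ, α ≠ a) (e : ℤ) (a : ℤ) : α - e ≠ a :=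
  fun h => hα (a + e) (by push_cast; linarith)

lemma LinkedTranslate.refl (D : DurfeeSymbol) : LinkedTranslate D D 0 where
  mem_maya x := by simp
  dbarOne_add_k := rfl
  dbarOne_add_kbar := by simp
  linked_left Δ α _ := by simpa using Linked.refl _ _
  linked_right Δ α _ := by simpa using Linked.refl _ _

lemma LinkedTranslate.symm {D D' : DurfeeSymbol} {e : ℤ} (h : LinkedTranslate D D' e) :
    LinkedTranslate D' D (-e) where
  mem_maya x := by simp [h.mem_maya]
  dbarOne_add_k := h.dbarOne_add_k.symm
  dbarOne_add_kbar := by rw [h.dbarOne_add_kbar]; ring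
  linked_left Δ α hα := by
    simpa using (h.linked_left Δ (α + e) (forall_add_intCast_ne hα e)).symm
  linked_right Δ α hα := by
    simpa [← sub_eq_add_neg] using
      (h.linked_right Δ (α - e) (forall_sub_intCast_ne hα e)).symm

lemma LinkedTranslate.trans {D D' D'' : DurfeeSymbol} {e e' : ℤ} (h : LinkedTranslate D D' e)
    (h' : LinkedTranslate D' D'' e') : LinkedTranslate D D'' (e + e') where
  mem_maya x := by rw [h.mem_maya, h'.mem_maya, add_assoc]
  dbarOne_add_k := by rw [h'.dbarOne_add_k, h.dbarOne_add_k]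
  dbarOne_add_kbar := by rw [h'.dbarOne_add_kbar, h.dbarOne_add_kbar]; ring
  linked_left Δ α hα := by
    have := (h.linked_left Δ α hα).trans (h'.linked_left Δ _ (forall_sub_intCast_ne hα e))
    rwa [sub_sub, ← Int.cast_add] at this
  linked_right Δ α hα := by
    have := (h.linked_right Δ α hα).trans (h'.linked_right Δ _ (forall_add_intCast_ne hα e))
    rwa [add_assoc, ← Int.cast_add] at this

/-- Box `0` is filled: translation to the left deletes the index `0`. -/
lemma linkedTranslate_of_d_eq_concat {D D' : DurfeeSymbol} (hd : D.d = D'.d ++ [0])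
    (hb : D'.dbar = D.dbar.map (· + 1)) : LinkedTranslate D D' (-1) where
  mem_maya x := by
    rw [mem_maya_iff, mem_maya_iff, hd, hb, indices_concat, indices_map_succ]
    simp only [List.mem_append, List.mem_map, List.mem_singleton]
    constructor
    · rintro (⟨_, ⟨n, hn, rfl⟩ | rfl, rfl⟩ | ⟨hx, h⟩)
      · exact Or.inl ⟨n, hn, by push_cast; ring⟩
      · refine Or.inr ⟨by simp, ?_⟩
        rintro _ ⟨m, -, rfl⟩
        push_cast
        omega
      · refine Or.inr ⟨by omega, ?_⟩
        rintro _ ⟨m, hm, rfl⟩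
        have := h m hm
        push_cast
        omega
    · rintro (⟨n, hn, hx⟩ | ⟨hx, h⟩)
      · exact Or.inl ⟨n + 1, Or.inl ⟨n, hn, rfl⟩, by push_cast; omega⟩
      · rcases eq_or_ne x 0 with rfl | hx0
        · exact Or.inl ⟨0, Or.inr rfl, rfl⟩
        · refine Or.inr ⟨by omega, fun m hm => ?_⟩
          have := h (m + 1) ⟨m, hm, rfl⟩
          push_cast at this
          omega
  dbarOne_add_k := by
    rw [dbarOne, dbarOne, hb, k, k, hd]
    rcases D.dbar with _ | ⟨b, l⟩
    · simp
      ring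
    · simp
      ring
  dbarOne_add_kbar := by
    rw [dbarOne, dbarOne, kbar, kbar, hb, hd]
    rcases D.dbar with _ | ⟨b, l⟩
    · simp
    · simp
      ring
  linked_left Δ α hα := by
    have := Linked.columns_spec_zero (indices D'.d) (indices D.dbar) (indices Δ.d)
      (indices Δ.dbar) hα
    simpa [labels, hd, hb, indices_concat, indices_map_succ] using this
  linked_right Δ α hα := by
    have := Linked.columns_shadow_zero (indices Δ.d) (indices Δ.dbar) (indices D'.d)
      (indices D.dbar) hα
    simpa [labels, hd, hb, indices_concat, indices_map_succ, ← sub_eq_add_neg] using this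

/-- Box `-1` is empty: translation to the right deletes the index `-1`. -/
lemma linkedTranslate_of_dbar_eq_concat {D D' : DurfeeSymbol} (hb : D.dbar = D'.dbar ++ [0])
    (hd : D'.d = D.d.map (· + 1)) : LinkedTranslate D D' 1 where
  mem_maya x := by
    rw [mem_maya_iff, mem_maya_iff, hd, hb, indices_concat, indices_map_succ]
    simp only [List.mem_append, List.mem_map, List.mem_singleton]
    constructor
    · rintro (⟨n, hn, rfl⟩ | ⟨hx, h⟩)
      · exact Or.inl ⟨n + 1, ⟨n, hn, rfl⟩, by push_cast; ring⟩
      · have h0 := h 0 (Or.inr rfl)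
        push_cast at h0
        refine Or.inr ⟨by omega, fun m hm => ?_⟩
        have := h (m + 1) (Or.inl ⟨m, hm, rfl⟩)
        push_cast at this
        omega
    · rintro (⟨_, ⟨n, hn, rfl⟩, hx⟩ | ⟨hx, h⟩)
      · exact Or.inl ⟨n, hn, by push_cast at hx; omega⟩
      · refine Or.inr ⟨by omega, ?_⟩
        rintro _ (⟨m, hm, rfl⟩ | rfl)
        · have := h m hm
          push_cast
          omega
        · push_cast
          omega
  dbarOne_add_k := by
    have h0 : List.count 0 (D.d.map (· + 1)) = 0 := by simp [List.count_eq_zero]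
    rw [dbarOne, dbarOne, hb, k, k, hd]
    rcases D'.dbar with _ | ⟨b, l⟩ <;> simp [h0]
  dbarOne_add_kbar := by
    have h0 : List.count 0 (D.d.map (· + 1)) = 0 := by simp [List.count_eq_zero]
    rw [dbarOne, dbarOne, hb, kbar, kbar, hb, hd]
    rcases D'.dbar with _ | ⟨b, l⟩ <;> simp [h0]
    ring
  linked_left Δ α hα := by
    have := Linked.columns_specBar_zero (indices D.d) (indices D'.dbar) (indices Δ.d)
      (indices Δ.dbar) hα
    simpa [labels, hd, hb, indices_concat, indices_map_succ] using this
  linked_right Δ α hα := by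
    have := Linked.columns_shadowBar_zero (indices Δ.d) (indices Δ.dbar) (indices D.d)
      (indices D'.dbar) hα
    simpa [labels, hd, hb, indices_concat, indices_map_succ] using this

/-- If the leftmost empty box is box `0`, the symbol is the canonical one of its shape class. -/
lemma dbar_eq_nil_and_n_pos {D : DurfeeSymbol} (h : D.dbarOne + D.kbar = 0) :
    D.dbar = [] ∧ ∀ j, 0 < D.n j := by
  rw [dbarOne, kbar] at h
  rcases hb : D.dbar with _ | ⟨b, l⟩
  · rw [hb] at h
    have h0 : 0 ∉ D.d := by
      rw [← List.count_eq_zero]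
      simpa using h
    refine ⟨rfl, fun j => Nat.add_pos_left (Nat.pos_of_ne_zero fun e => h0 ?_) _⟩
    rw [← e]
    exact List.get_mem _ _
  · rw [hb] at h
    simp at h
    omega

/-- A symbol whose leftmost empty box is not box `0` has a linked translate by one box, whose
leftmost empty box is closer to box `0`. -/
lemma exists_linkedTranslate_closer {D : DurfeeSymbol} (h : D.dbarOne + D.kbar ≠ 0) :
    ∃ D' e, LinkedTranslate D D' e ∧
      (D'.dbarOne + D'.kbar).natAbs < (D.dbarOne + D.kbar).natAbs := by
  rcases List.eq_nil_or_concat D.dbar with hb | ⟨l, a, hb⟩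
  · have hneg : D.dbarOne + D.kbar ≤ 0 := by simp [dbarOne, kbar, hb]
    have h0 : 0 ∈ D.d := by
      rw [← List.count_pos_iff, Nat.pos_iff_ne_zero]
      simpa [dbarOne, kbar, hb] using h
    rcases List.eq_nil_or_concat D.d with hd | ⟨l, a, hd⟩
    · simp [hd] at h0
    · rw [List.concat_eq_append] at hd
      have hs := D.d_sorted
      rw [hd, List.pairwise_append] at hs
      have ha : a = 0 := by
        rw [hd, List.mem_append, List.mem_singleton] at h0
        rcases h0 with h0 | h0
        · simpa using hs.2.2 0 h0 a (by simp)
        · exact h0.symm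
      subst ha
      have ht := linkedTranslate_of_d_eq_concat (D := D)
        (D' := ⟨l, [], hs.1, List.Pairwise.nil⟩) hd (by simp [hb])
      refine ⟨_, _, ht, ?_⟩
      rw [ht.dbarOne_add_kbar]
      omega
  · rw [List.concat_eq_append] at hb
    have hpos : 0 < D.dbarOne + D.kbar := by
      rw [dbarOne, kbar, hb]
      rcases l with _ | ⟨b, l⟩
      · simp
      · simp
        omega
    have hs := D.dbar_sorted
    rw [hb, List.pairwise_append] at hs
    rcases a with _ | a
    · have ht := linkedTranslate_of_dbar_eq_concat (D := D)
        (D' := ⟨D.d.map (· + 1), l, List.pairwise_map.mpr (D.d_sorted.imp (by simp)), hs.1⟩)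
        hb rfl
      refine ⟨_, _, ht, ?_⟩
      rw [ht.dbarOne_add_kbar]
      omega
    · have h1 : ∀ b ∈ D.dbar, 1 ≤ b := by
        intro b hbm
        rw [hb, List.mem_append, List.mem_singleton] at hbm
        rcases hbm with hbm | rfl
        · have := hs.2.2 b hbm (a + 1) (by simp)
          omega
        · omega
      -- Box `-1` is filled, so the translate to the right has the index `0`.
      have ht := (linkedTranslate_of_d_eq_concat (D' := D)
        (D := ⟨D.d ++ [0], D.dbar.map (· - 1),
          List.pairwise_append.mpr ⟨D.d_sorted, by simp, by simp⟩,
          List.pairwise_map.mpr (D.dbar_sorted.imp (by intros; omega))⟩) rfl (by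
            rw [List.map_map]
            conv_lhs => rw [← List.map_id D.dbar]
            exact List.map_congr_left fun b hbm => (Nat.sub_add_cancel (h1 b hbm)).symm)).symm
      refine ⟨_, _, ht, ?_⟩
      rw [ht.dbarOne_add_kbar]
      omega

lemma exists_linkedTranslate_canonical (D : DurfeeSymbol) :
    ∃ E, LinkedTranslate D E (D.dbarOne + D.kbar) ∧ E.dbarOne + E.kbar = 0 := by
  induction hm : (D.dbarOne + D.kbar).natAbs using Nat.strong_induction_on generalizing D with
  | _ m ih =>
    by_cases h : D.dbarOne + D.kbar = 0
    · exact ⟨D, h ▸ LinkedTranslate.refl D, h⟩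
    · obtain ⟨D', e, ht, hlt⟩ := exists_linkedTranslate_closer h
      obtain ⟨E, hE, hE0⟩ := ih _ (hm ▸ hlt) D' rfl
      refine ⟨E, ?_, hE0⟩
      have := ht.trans hE
      rwa [ht.dbarOne_add_kbar, add_sub_cancel] at this

lemma LinkedTranslate.isCanonicalRep {D E : DurfeeSymbol} {e : ℤ} (h : LinkedTranslate D E e)
    (hE : E.dbarOne + E.kbar = 0) : E.IsCanonicalRep D ∧ (E.k : ℤ) = D.dbarOne + D.k := by
  obtain ⟨h1, h2⟩ := dbar_eq_nil_and_n_pos hE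
  refine ⟨⟨⟨e, h.mem_maya⟩, h1, h2⟩, ?_⟩
  rw [← h.dbarOne_add_k]
  have : E.kbar = 0 := by simp [kbar, h1]
  rw [this] at hE
  omega

end DurfeeSymbol

end

open DurfeeSymbol

theorem mainTheorem1 (D Δ : DurfeeSymbol) :
    ∃ lam mu : DurfeeSymbol,
      lam.IsCanonicalRep D ∧ mu.IsCanonicalRep Δ ∧
      (lam.k : ℤ) = D.dbarOne + D.k ∧ (mu.k : ℤ) = Δ.dbarOne + Δ.k ∧
      ∀ α : ℝ, (∀ a : ℤ, α ≠ a) →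
        ∃ c : ℝ, c ≠ 0 ∧ ∀ z : ℝ, z ≠ 0 →
          (pseudoWronskian D Δ α).eval z =
            c * z ^ (((D.kbar : ℤ) + Δ.k) * (D.kbar + Δ.k - 1)
                - (Δ.dbarOne + Δ.k) * (Δ.dbarOne + Δ.k - 1)) *
              (pseudoWronskian lam mu
                (α - ((D.dbarOne + D.kbar : ℤ) : ℝ)
                  + ((Δ.dbarOne + Δ.kbar : ℤ) : ℝ))).eval z := by
  obtain ⟨lam, hlam, hlam0⟩ := D.exists_linkedTranslate_canonical
  obtain ⟨mu, hmu, hmu0⟩ := Δ.exists_linkedTranslate_canonical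
  obtain ⟨hlamc, hlamk⟩ := hlam.isCanonicalRep hlam0
  obtain ⟨hmuc, hmuk⟩ := hmu.isCanonicalRep hmu0
  refine ⟨lam, mu, hlamc, hmuc, hlamk, hmuk, fun α hα => ?_⟩
  obtain ⟨c, hc, h⟩ := (hlam.linked_left Δ α hα).trans
    (hmu.linked_right lam _ (forall_sub_intCast_ne hα _))
  refine ⟨c, hc, fun z hz => ?_⟩
  have hkbar : lam.kbar = 0 := by simp [kbar, hlamc.2.1]
  have hz' := h z hz
  rw [normDet, normDet, ← eval_pseudoWronskian, ← eval_pseudoWronskian, totalWeight_labels,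
    totalWeight_labels, hkbar, zpow_neg, inv_mul_eq_iff_eq_mul₀ (zpow_ne_zero _ hz)] at hz'
  rw [hz', ← hmuk, zpow_sub₀ hz, zpow_neg, zero_add, Nat.cast_add]
  ring
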